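/- Let $F$ be $\mathbf R$ with its usual absolute value, or $\mathbf Q_p$ for some prime $p$ with its $p$-adic absolute value ($|p|=1/p$). Let $K$ be a local field of characteristic zero, i.e. a finite extension of such an $F$, equipped with the absolute value extending that of $F$, and let $b_K=[K:F]$ (so $b_{\mathbf R}=1$ and $b_{\mathbf C}=2$). Let $n\ge 1$ and let $|A|$ denote the Haar measure of $A\subset K^n$ (Lebesgue measure in the archimedean case; any fixed normalization). Let $U$ be a bounded neighborhood of the origin in $K^n$, and let $f$ be a $K$-valued function that is analytic at every point of $\mathrm{cl}(U)$, i.e. near each such point $f$ is the sum of a convergent power series centered at that point (this holds in particular if the Taylor series of $f$ at the origin converges to $f$ on a neighborhood of $\mathrm{cl}(U)$). Suppose that there is an integer $k>0$ such that $\partial_{x_n}^k f(x)\neq 0$ for all $x\in\mathrm{cl}(U)$. Then there is a constant $B$, independent of $\epsilon$ (but allowed to depend on $f$ and the other data), such that for all $\epsilon>0$ $$|\{x\in U: |f(x)|<\epsilon\}| < B\,\epsilon^{b_K/k}.$$ -/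

import Mathlib

/-- The completions of the rational numbers: `ℝ` with its usual absolute value and, for each
prime `p`, the field `ℚ_[p]` with the `p`-adic absolute value `|p| = 1 / p`.  A local field of
characteristic zero is a finite extension `K` of one of these fields `F`, with the absolute value
that extends the one of `F`; the number `b_K` is the degree `Module.finrank F K`. -/
inductive IsRatCompletion : (F : Type) → [NontriviallyNormedField F] → Prop
  | real : IsRatCompletion ℝ
  | padic (p : ℕ) [Fact p.Prime] : IsRatCompletion ℚ_[p]

/-- The pure partial derivative of order `k` in the `i`-th coordinate: the `k`-th derivative of
`f` restricted to the line through `x` parallel to the `i`-th axis. -/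
noncomputable def iteratedPartialDeriv {K : Type*} [NontriviallyNormedField K] {m : ℕ}
    (i : Fin m) (k : ℕ) (f : (Fin m → K) → K) (x : Fin m → K) : K :=
  iteratedDeriv k (fun t : K => f (Function.update x i t)) (x i)

/-!
The proof treats `ℝ`, `ℂ` and the `p`-adic fields alike, replacing the mean value theorem by divided
differences. For distinct nodes `T = {t₀, …, t_k}` put `g[T] = ∑ t ∈ T, g t / ∏ u ≠ t, (t - u)`.

* Near a point `x₀`, the divided differences of order `k` of `f` along lines parallel to the last
  axis are close to `∂ₙ ^ k f (x₀) / k!`, which is not zero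
  (`HasFPowerSeriesAt.exists_norm_dividedDiff_sub_lt`). To see this, expand `f` in its power series
  at `x₀`. Along a line, the homogeneous term of degree `m` is a polynomial of degree `m`: its
  divided difference is `0` for `m < k`, is the term evaluated at the direction of the line for
  `m = k`, and for `m > k` is small near `x₀`, since `s ^ m` has the complete homogeneous symmetric
  polynomial of degree `m - k` in the nodes as its divided difference
  (`norm_dividedDiff_pow_mul_le`).
* If `‖g‖ < ε` on `k + 1` nodes with mutual distances at least `δ`, then `‖g[T]‖` is at most
  `(k + 1) * ε / δ ^ k` (`norm_dividedDiff_mul_le`). So the part of the sublevel set on a line near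
  `x₀` cannot contain such nodes when `δ` is a large multiple of `ε ^ (1 / k)`, and is then covered
  by `k` balls of radius `δ` (`HasFPowerSeriesAt.exists_sublevel_cover`).
* A ball of radius `δ` in `K` has Haar measure `O(δ ^ [K : F])`, by packing disjoint translates of
  it into a fixed ball (`IsRatCompletion.exists_measure_ball_le`).

Fubini's theorem turns the bound on lines into a bound near `x₀`
(`exists_nhds_measure_sublevel_le`), and compactness of `closure U` concludes.
-/

open Metric Filter Topology MeasureTheory

/-! ### Divided differences -/

/-- The divided difference `g[t₀, …, t_k]` of `g` on the nodes `T = {t₀, …, t_k}`, in Lagrange's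
form, which is visibly linear in `g` and symmetric in the nodes. -/
noncomputable def dividedDiff {K : Type*} [Field K] (T : Finset K) (g : K → K) : K :=
  open Classical in ∑ t ∈ T, g t / ∏ u ∈ T.erase t, (t - u)

section DividedDifferences

variable {K : Type*} [Field K]

theorem dividedDiff_singleton (t : K) (g : K → K) : dividedDiff {t} g = g t := by
  simp [dividedDiff]

theorem dividedDiff_empty (g : K → K) : dividedDiff ∅ g = 0 := by
  simp [dividedDiff]

theorem dividedDiff_mul_const (T : Finset K) (g : K → K) (c : K) :
    dividedDiff T (fun s => g s * c) = dividedDiff T g * c := by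
  simp only [dividedDiff, Finset.sum_mul]
  exact Finset.sum_congr rfl fun t _ => by ring

theorem dividedDiff_sum {ι : Type*} (T : Finset K) (S : Finset ι) (g : ι → K → K) :
    dividedDiff T (fun s => ∑ i ∈ S, g i s) = ∑ i ∈ S, dividedDiff T (g i) := by
  simp only [dividedDiff, Finset.sum_div]
  exact Finset.sum_comm

/-- The Leibniz rule for the product with the identity function. -/
theorem dividedDiff_id_mul {T : Finset K} {a : K} (haT : a ∉ T) (g : K → K) :
    dividedDiff (T.cons a haT) (fun s => s * g s) =
      a * dividedDiff (T.cons a haT) g + dividedDiff T g := by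
  classical
  rw [← sub_eq_iff_eq_add']
  simp only [dividedDiff, Finset.mul_sum]
  rw [← Finset.sum_sub_distrib, Finset.sum_cons]
  have h0 : ∀ x : K, a * g a / x - a * (g a / x) = 0 := fun x => by ring
  rw [h0, zero_add]
  refine Finset.sum_congr rfl fun t ht => ?_
  have hta : t ≠ a := fun h => haT (h ▸ ht)
  have hsub : t - a ≠ 0 := sub_ne_zero.2 hta
  have hprod : ∏ u ∈ (T.cons a haT).erase t, (t - u) = (t - a) * ∏ u ∈ T.erase t, (t - u) := by
    rw [Finset.cons_eq_insert, Finset.erase_insert_of_ne hta.symm, Finset.prod_insert]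
    exact fun h => haT (Finset.mem_of_mem_erase h)
  rw [hprod, mul_div_assoc, ← sub_mul, ← mul_div_assoc, mul_div_mul_left _ _ hsub]

/-- The divided difference of a constant on two or more nodes vanishes. -/
theorem dividedDiff_one {T : Finset K} (hT : 2 ≤ T.card) : dividedDiff T (fun _ => 1) = 0 := by
  classical
  have h := Lagrange.coeff_eq_sum (s := T) (v := id) (Set.injOn_id _) (P := 1)
    (by rw [Polynomial.degree_one]; exact_mod_cast (by omega : 0 < T.card))
  rw [Polynomial.coeff_one, if_neg (by omega)] at h
  simpa [dividedDiff] using h.symm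

theorem dividedDiff_pow_of_lt {T : Finset K} {m : ℕ} (h : m + 1 < T.card) :
    dividedDiff T (fun s => s ^ m) = 0 := by
  induction m generalizing T with
  | zero => simpa using dividedDiff_one (T := T) (by omega)
  | succ m ih =>
    obtain ⟨a, ha⟩ : T.Nonempty := Finset.card_pos.1 (by omega)
    classical
    obtain ⟨T, haT, rfl⟩ : ∃ T' : Finset K, ∃ h : a ∉ T', T = T'.cons a h :=
      ⟨T.erase a, by simp, by simp [Finset.insert_erase ha]⟩
    rw [Finset.card_cons] at h
    simp only [pow_succ']
    rw [dividedDiff_id_mul, ih (by rw [Finset.card_cons]; omega), ih (by omega)]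
    simp

theorem dividedDiff_pow_eq_one {T : Finset K} {m : ℕ} (h : T.card = m + 1) :
    dividedDiff T (fun s => s ^ m) = 1 := by
  induction m generalizing T with
  | zero =>
    obtain ⟨a, rfl⟩ := Finset.card_eq_one.1 h
    simp [dividedDiff_singleton]
  | succ m ih =>
    obtain ⟨a, ha⟩ : T.Nonempty := Finset.card_pos.1 (by omega)
    classical
    obtain ⟨T, haT, rfl⟩ : ∃ T' : Finset K, ∃ h : a ∉ T', T = T'.cons a h :=
      ⟨T.erase a, by simp, by simp [Finset.insert_erase ha]⟩
    rw [Finset.card_cons] at h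
    simp only [pow_succ']
    rw [dividedDiff_id_mul, dividedDiff_pow_of_lt (by rw [Finset.card_cons]; omega),
      ih (by omega)]
    simp

end DividedDifferences

/-! ### Bounds on divided differences -/

section Estimates

variable {K : Type*} [NontriviallyNormedField K]

/-- The divided difference of order `k` of `s ^ m` is the complete homogeneous symmetric polynomial
of degree `m - k` in the nodes, so it is `O(ρ ^ (m - k))` on the ball of radius `ρ`. The factor
`ρ ^ k` on the left makes the bound meaningful for `m < k` too. -/
theorem norm_dividedDiff_pow_mul_le {ρ : ℝ} (hρ : 0 ≤ ρ) (m : ℕ) (T : Finset K)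
    (hT : ∀ t ∈ T, ‖t‖ ≤ ρ) (k : ℕ) (hk : T.card = k + 1) :
    ‖dividedDiff T (fun s => s ^ m)‖ * ρ ^ k ≤ (2 * ρ) ^ m := by
  induction m generalizing T k with
  | zero =>
    rcases Nat.eq_zero_or_pos k with rfl | hk0
    · obtain ⟨a, rfl⟩ := Finset.card_eq_one.1 hk
      simp [dividedDiff_singleton]
    · rw [dividedDiff_pow_of_lt (by omega)]
      simp
  | succ m ih =>
    obtain ⟨a, ha⟩ : T.Nonempty := Finset.card_pos.1 (by omega)
    classical
    obtain ⟨T, haT, rfl⟩ : ∃ T' : Finset K, ∃ h : a ∉ T', T = T'.cons a h :=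
      ⟨T.erase a, by simp, by simp [Finset.insert_erase ha]⟩
    have hcons := ih _ hT k hk
    rw [Finset.card_cons] at hk
    have haρ : ‖a‖ ≤ ρ := hT a (Finset.mem_cons_self a T)
    have hrest : ‖dividedDiff T (fun s => s ^ m)‖ * ρ ^ k ≤ ρ * (2 * ρ) ^ m := by
      rcases k with _ | k
      · rw [Finset.card_eq_zero.1 (by omega : T.card = 0), dividedDiff_empty]
        simpa using by positivity
      · calc _ = ρ * (‖dividedDiff T (fun s => s ^ m)‖ * ρ ^ k) := by ring
          _ ≤ _ := mul_le_mul_of_nonneg_left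
            (ih T (fun t ht => hT t (Finset.mem_cons_of_mem ht)) k (by omega)) hρ
    simp only [pow_succ' _ m]
    rw [dividedDiff_id_mul]
    calc _ ≤ (‖a‖ * ‖dividedDiff (T.cons a haT) (fun s => s ^ m)‖ +
            ‖dividedDiff T (fun s => s ^ m)‖) * ρ ^ k := by
          gcongr
          exact (norm_add_le _ _).trans (by rw [norm_mul])
      _ = ‖a‖ * (‖dividedDiff (T.cons a haT) (fun s => s ^ m)‖ * ρ ^ k) +
            ‖dividedDiff T (fun s => s ^ m)‖ * ρ ^ k := by ring
      _ ≤ ρ * (2 * ρ) ^ m + ρ * (2 * ρ) ^ m := by gcongr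
      _ = 2 * ρ * (2 * ρ) ^ m := by ring

/-- Separated nodes: a function that is small on nodes with mutual distances at least `δ` has a
small divided difference. -/
theorem norm_dividedDiff_mul_le {T : Finset K} {k : ℕ} (hT : T.card = k + 1) {g : K → K}
    {ε δ : ℝ} (hδ : 0 < δ) (hsep : ∀ t ∈ T, ∀ u ∈ T, t ≠ u → δ ≤ ‖t - u‖)
    (hg : ∀ t ∈ T, ‖g t‖ ≤ ε) :
    ‖dividedDiff T g‖ * δ ^ k ≤ (k + 1) * ε := by
  classical
  have hterm : ∀ t ∈ T, ‖g t / ∏ u ∈ T.erase t, (t - u)‖ ≤ ε / δ ^ k := by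
    intro t ht
    rw [norm_div, norm_prod]
    have hprod : δ ^ k ≤ ∏ u ∈ T.erase t, ‖t - u‖ := by
      have hcard : (T.erase t).card = k := by rw [Finset.card_erase_of_mem ht, hT]; rfl
      rw [← hcard, ← Finset.prod_const]
      refine Finset.prod_le_prod (fun _ _ => hδ.le) fun u hu => ?_
      exact hsep t ht u (Finset.mem_of_mem_erase hu) (Finset.ne_of_mem_erase hu).symm
    exact div_le_div₀ ((norm_nonneg _).trans (hg t ht)) (hg t ht) (by positivity) hprod
  have hsum : ‖dividedDiff T g‖ ≤ (k + 1) * (ε / δ ^ k) := by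
    refine (norm_sum_le_of_le T hterm).trans (le_of_eq ?_)
    rw [Finset.sum_const, hT, nsmul_eq_mul]
    push_cast
    rfl
  calc _ ≤ (k + 1) * (ε / δ ^ k) * δ ^ k := by gcongr
    _ = _ := by field_simp

/-- A set without `k + 1` points of mutual distances at least `δ` is covered by `k` balls of radius
`δ`: a separated subset of maximal cardinality provides the centres. -/
theorem exists_finset_cover_of_no_separated {X : Type*} [PseudoMetricSpace X] (E : Set X) {δ : ℝ}
    (hδ : 0 < δ) (k : ℕ)
    (h : ∀ T : Finset X, (T : Set X) ⊆ E → (∀ t ∈ T, ∀ u ∈ T, t ≠ u → δ ≤ dist t u) →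
      T.card ≠ k + 1) :
    ∃ T : Finset X, T.card ≤ k ∧ E ⊆ ⋃ t ∈ T, ball t δ := by
  classical
  let P : ℕ → Prop := fun j => ∃ T : Finset X, (T : Set X) ⊆ E ∧
    (∀ t ∈ T, ∀ u ∈ T, t ≠ u → δ ≤ dist t u) ∧ T.card = j
  have h0 : P 0 := ⟨∅, by simp⟩
  obtain ⟨T, hTE, hsep, hcard⟩ := Nat.findGreatest_spec (P := P) (Nat.zero_le k) h0
  refine ⟨T, hcard.trans_le (Nat.findGreatest_le k), fun x hx => ?_⟩
  by_contra hcov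
  simp only [Set.mem_iUnion, mem_ball, not_exists, not_lt] at hcov
  have hxT : x ∉ T := fun hxT => (hcov x hxT).not_gt (by simpa using hδ)
  have hEx : ((T.cons x hxT : Finset X) : Set X) ⊆ E := by
    rw [Finset.coe_cons]
    exact Set.insert_subset hx hTE
  have hsepx : ∀ t ∈ T.cons x hxT, ∀ u ∈ T.cons x hxT, t ≠ u → δ ≤ dist t u := by
    intro t ht u hu htu
    rcases Finset.mem_cons.1 ht with rfl | ht' <;> rcases Finset.mem_cons.1 hu with rfl | hu'
    · exact absurd rfl htu
    · exact hcov u hu'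
    · rw [dist_comm]
      exact hcov t ht'
    · exact hsep t ht' u hu' htu
  have hle : T.card ≤ k := hcard.trans_le (Nat.findGreatest_le k)
  have hne := h _ hEx hsepx
  rw [Finset.card_cons] at hne
  have hmax := Nat.le_findGreatest (P := P) (by omega : T.card + 1 ≤ k)
    ⟨T.cons x hxT, hEx, hsepx, Finset.card_cons hxT⟩
  omega

end Estimates

/-! ### Divided differences of analytic functions -/

section PowerSeries

variable {K : Type*} [NontriviallyNormedField K]
  {E : Type*} [NormedAddCommGroup E] [NormedSpace K E]

/-- Binomial expansion of a homogeneous polynomial along a line. -/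
theorem ContinuousMultilinearMap.apply_add_smul_eq_sum {m : ℕ}
    (q : ContinuousMultilinearMap K (fun _ : Fin m => E) K) (v e : E) (s : K) :
    q (fun _ => v + s • e) =
      ∑ S : Finset (Fin m), s ^ S.card * q (S.piecewise (fun _ => e) (fun _ => v)) := by
  classical
  have hfun : (fun _ : Fin m => v + s • e) = (fun _ => s • e) + fun _ => v := by
    ext1 i
    simp [add_comm]
  rw [hfun, q.map_add_univ]
  refine Finset.sum_congr rfl fun S _ => ?_
  have h := q.map_piecewise_smul (fun _ => s) (S.piecewise (fun _ => e) (fun _ => v)) S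
  rw [Finset.prod_const, smul_eq_mul] at h
  rw [← h]
  congr 1
  ext1 i
  by_cases hi : i ∈ S <;> simp [hi]

theorem dividedDiff_homogeneous {m : ℕ}
    (q : ContinuousMultilinearMap K (fun _ : Fin m => E) K) (v e : E) (T : Finset K) :
    dividedDiff T (fun s => q (fun _ => v + s • e)) =
      ∑ S : Finset (Fin m), dividedDiff T (fun s => s ^ S.card) *
        q (S.piecewise (fun _ => e) (fun _ => v)) := by
  simp only [q.apply_add_smul_eq_sum, dividedDiff_sum, dividedDiff_mul_const]

theorem dividedDiff_homogeneous_of_lt {m : ℕ}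
    (q : ContinuousMultilinearMap K (fun _ : Fin m => E) K) (v e : E) {T : Finset K}
    (hT : m + 1 < T.card) :
    dividedDiff T (fun s => q (fun _ => v + s • e)) = 0 := by
  rw [dividedDiff_homogeneous]
  refine Finset.sum_eq_zero fun S _ => ?_
  have hS : S.card ≤ m := by simpa using S.card_le_univ
  rw [dividedDiff_pow_of_lt (by omega), zero_mul]

theorem dividedDiff_homogeneous_of_eq {m : ℕ}
    (q : ContinuousMultilinearMap K (fun _ : Fin m => E) K) (v e : E) {T : Finset K}
    (hT : T.card = m + 1) :
    dividedDiff T (fun s => q (fun _ => v + s • e)) = q (fun _ => e) := by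
  rw [dividedDiff_homogeneous, Finset.sum_eq_single Finset.univ]
  · rw [Finset.card_univ, Fintype.card_fin, dividedDiff_pow_eq_one hT, one_mul,
      Finset.piecewise_univ]
  · intro S _ hS
    have hlt : S.card < m := by
      simpa using Finset.card_lt_card (Finset.ssubset_univ_iff.2 hS)
    rw [dividedDiff_pow_of_lt (by omega), zero_mul]
  · simp

theorem norm_dividedDiff_homogeneous_mul_le {m : ℕ}
    (q : ContinuousMultilinearMap K (fun _ : Fin m => E) K) {v e : E} {ρ : ℝ}
    (hv : ‖v‖ ≤ ρ) (he : ‖e‖ ≤ 1) {T : Finset K} {k : ℕ} (hT : T.card = k + 1)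
    (hTρ : ∀ t ∈ T, ‖t‖ ≤ ρ) :
    ‖dividedDiff T (fun s => q (fun _ => v + s • e))‖ * ρ ^ k ≤ ‖q‖ * (4 * ρ) ^ m := by
  have hρ : 0 ≤ ρ := (norm_nonneg v).trans hv
  rw [dividedDiff_homogeneous]
  have hterm : ∀ S : Finset (Fin m), ‖dividedDiff T (fun s => s ^ S.card) *
      q (S.piecewise (fun _ => e) (fun _ => v))‖ * ρ ^ k ≤ ‖q‖ * (2 * ρ) ^ m := by
    intro S
    have hS : S.card ≤ m := by simpa using S.card_le_univ
    have hq : ‖q (S.piecewise (fun _ => e) (fun _ => v))‖ ≤ ‖q‖ * ρ ^ (m - S.card) := by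
      refine (q.le_opNorm _).trans (mul_le_mul_of_nonneg_left ?_ (norm_nonneg q))
      calc _ = ∏ i, S.piecewise (fun _ => ‖e‖) (fun _ => ‖v‖) i :=
            Finset.prod_congr rfl fun i _ => by by_cases hi : i ∈ S <;> simp [hi]
        _ = ‖e‖ ^ S.card * ‖v‖ ^ (m - S.card) := by
            rw [Finset.prod_piecewise]
            simp [← Finset.compl_eq_univ_sdiff, Finset.card_compl]
        _ ≤ 1 * ρ ^ (m - S.card) := by
            gcongr
            exact pow_le_one₀ (norm_nonneg e) he
        _ = _ := one_mul _
    calc _ = (‖dividedDiff T (fun s => s ^ S.card)‖ * ρ ^ k) *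
            ‖q (S.piecewise (fun _ => e) (fun _ => v))‖ := by rw [norm_mul]; ring
      _ ≤ (2 * ρ) ^ S.card * (‖q‖ * ρ ^ (m - S.card)) := by
          gcongr
          exact norm_dividedDiff_pow_mul_le hρ _ T hTρ k hT
      _ ≤ (2 * ρ) ^ S.card * (‖q‖ * (2 * ρ) ^ (m - S.card)) := by
          gcongr
          linarith
      _ = ‖q‖ * ((2 * ρ) ^ S.card * (2 * ρ) ^ (m - S.card)) := by ring
      _ = _ := by rw [← pow_add, Nat.add_sub_cancel' hS]
  calc _ ≤ (∑ S : Finset (Fin m), ‖dividedDiff T (fun s => s ^ S.card) *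
            q (S.piecewise (fun _ => e) (fun _ => v))‖) * ρ ^ k := by
        gcongr
        exact norm_sum_le _ _
    _ ≤ ∑ _S : Finset (Fin m), ‖q‖ * (2 * ρ) ^ m := by
        rw [Finset.sum_mul]
        exact Finset.sum_le_sum fun S _ => hterm S
    _ = ‖q‖ * ((2 * (2 * ρ)) ^ m) := by
        rw [Finset.sum_const, Finset.card_univ, Fintype.card_finset, Fintype.card_fin,
          mul_pow 2 (2 * ρ)]
        push_cast [nsmul_eq_mul]
        ring
    _ = _ := by rw [← mul_assoc 2 2 ρ]; norm_num

/-- The divided differences of order `k` of an analytic function along lines of direction `e` tend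
to the value at `e` of the degree-`k` term of the power series, uniformly as the nodes and the line
approach the centre. The Taylor expansion is done in all the variables at once, so nothing has to
be re-expanded when the line moves. -/
theorem HasFPowerSeriesAt.exists_norm_dividedDiff_sub_lt {f : E → K}
    {p : FormalMultilinearSeries K E K} {x : E} (hf : HasFPowerSeriesAt f p x) {e : E}
    (he : ‖e‖ ≤ 1) (k : ℕ) {η : ℝ} (hη : 0 < η) :
    ∃ ρ₀ > 0, ∀ ρ, 0 < ρ → ρ ≤ ρ₀ → ∀ v : E, ‖v‖ ≤ ρ → ∀ T : Finset K, T.card = k + 1 →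
      (∀ t ∈ T, ‖t‖ ≤ ρ) →
      ‖dividedDiff T (fun s => f (x + (v + s • e))) - p k (fun _ => e)‖ ≤ η := by
  obtain ⟨R, hR⟩ := hf
  obtain ⟨r, hr0, hrR⟩ := ENNReal.lt_iff_exists_nnreal_btwn.1 hR.r_pos
  have hr : (0 : ℝ) < r := by exact_mod_cast hr0
  obtain ⟨C, hC, hpC⟩ := p.norm_mul_pow_le_of_lt_radius (hrR.trans_le hR.r_le)
  refine ⟨min (r / 8) (η / (2 * C * (4 / r) ^ (k + 1))), by positivity, ?_⟩
  intro ρ hρ hρ₀ v hv T hT hTρ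
  have hρr : ρ ≤ r / 8 := hρ₀.trans (min_le_left _ _)
  have hρη : ρ * (2 * C * (4 / r) ^ (k + 1)) ≤ η :=
    (le_div_iff₀ (by positivity)).1 (hρ₀.trans (min_le_right _ _))
  set a : ℕ → K := fun m => dividedDiff T (fun s => p m (fun _ => v + s • e)) with ha
  have hsum : HasSum a (dividedDiff T (fun s => f (x + (v + s • e)))) := by
    refine hasSum_sum fun t ht => ?_
    refine HasSum.div_const (hR.hasSum ?_) _
    rw [mem_eball_zero_iff]
    refine lt_of_le_of_lt ?_ hrR
    rw [← ofReal_norm]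
    refine ENNReal.ofReal_le_of_le_toReal ?_
    rw [ENNReal.coe_toReal]
    calc ‖v + t • e‖ ≤ ‖v‖ + ‖t‖ * ‖e‖ := (norm_add_le _ _).trans (by rw [norm_smul])
      _ ≤ ρ + ρ * 1 := by gcongr; exact hTρ t ht
      _ ≤ r := by linarith
  have hlow : ∑ m ∈ Finset.range (k + 1), a m = p k (fun _ => e) := by
    rw [Finset.sum_range_succ, Finset.sum_eq_zero, zero_add]
    · exact dividedDiff_homogeneous_of_eq (p k) v e hT
    · intro m hm
      exact dividedDiff_homogeneous_of_lt (p m) v e (by rw [hT]; simpa using hm)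
  have htail : HasSum (fun m => a (m + (k + 1)))
      (dividedDiff T (fun s => f (x + (v + s • e))) - p k (fun _ => e)) := by
    rw [← hlow]
    exact (hasSum_nat_add_iff' (k + 1)).2 hsum
  set θ : ℝ := 4 * ρ / r with hθ
  have hθ2 : θ ≤ 1 / 2 := by
    rw [hθ, div_le_iff₀ hr]
    linarith
  have hterm : ∀ m, ‖a (m + (k + 1))‖ ≤ C * (4 / r) ^ (k + 1) * ρ * (1 / 2) ^ m := by
    intro m
    have h1 : ‖a (m + (k + 1))‖ * ρ ^ k ≤ C * θ ^ (m + (k + 1)) := by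
      refine (norm_dividedDiff_homogeneous_mul_le (p (m + (k + 1))) hv he hT hTρ).trans ?_
      calc _ = ‖p (m + (k + 1))‖ * r ^ (m + (k + 1)) * θ ^ (m + (k + 1)) := by
            rw [mul_assoc, ← mul_pow, hθ, mul_div_cancel₀ _ hr.ne']
        _ ≤ _ := by
            gcongr
            exact hpC _
    have h2 : C * θ ^ (m + (k + 1)) = C * (4 / r) ^ (k + 1) * ρ * θ ^ m * ρ ^ k := by
      rw [pow_add, hθ, mul_div_right_comm, mul_pow _ ρ (k + 1)]
      ring
    rw [h2] at h1
    refine (le_of_mul_le_mul_right h1 (by positivity)).trans ?_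
    gcongr
  have hgeom := (hasSum_geometric_two).mul_left (C * (4 / r) ^ (k + 1) * ρ)
  calc _ ≤ C * (4 / r) ^ (k + 1) * ρ * 2 := by
        rw [← htail.tsum_eq]
        exact tsum_of_norm_bounded hgeom hterm
    _ = ρ * (2 * C * (4 / r) ^ (k + 1)) := by ring
    _ ≤ η := hρη

/-- Near a point where the degree-`k` term of the power series does not vanish in the direction
`e`, the part of the sublevel set `‖f‖ < ε` on each line of direction `e` is covered by `k` balls
of radius `O(ε ^ (1 / k))`. -/
theorem HasFPowerSeriesAt.exists_sublevel_cover {f : E → K}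
    {p : FormalMultilinearSeries K E K} {x : E} (hf : HasFPowerSeriesAt f p x) {e : E}
    (he : ‖e‖ ≤ 1) {k : ℕ} (hk : 0 < k) (hp : p k (fun _ => e) ≠ 0) :
    ∃ C > 0, ∃ ρ > 0, ρ ≤ 1 ∧ ∀ v : E, ‖v‖ ≤ ρ → ∀ ε : ℝ, 0 < ε →
      ∃ T : Finset K, T.card ≤ k ∧
        {s : K | ‖s‖ ≤ ρ ∧ ‖f (x + (v + s • e))‖ < ε} ⊆
          ⋃ t ∈ T, ball t (C * ε ^ (1 / k : ℝ)) := by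
  set c : ℝ := ‖p k (fun _ => e)‖ with hc
  have hc0 : 0 < c := norm_pos_iff.2 hp
  obtain ⟨ρ₀, hρ₀, h⟩ := hf.exists_norm_dividedDiff_sub_lt he k (half_pos hc0)
  -- With `C ^ k * c / 2` larger than `k + 1`, nodes at distance `C * ε ^ (1 / k)` in the sublevel
  -- set would have a divided difference smaller than `c / 2`.
  set D : ℝ := 4 * (k + 1) / c with hD
  have hD0 : 0 < D := by positivity
  refine ⟨D ^ (1 / k : ℝ), by positivity, min ρ₀ 1, by positivity, min_le_right _ _, ?_⟩
  intro v hv ε hε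
  have hδ : 0 < D ^ (1 / k : ℝ) * ε ^ (1 / k : ℝ) := by positivity
  refine exists_finset_cover_of_no_separated _ hδ k fun T hTE hsep hT => ?_
  have hclose := h (min ρ₀ 1) (by positivity) (min_le_left _ _) v hv T hT
    fun t ht => (hTE ht).1
  have hsmall := norm_dividedDiff_mul_le hT hδ
    (fun t ht u hu htu => (hsep t ht u hu htu).trans_eq (dist_eq_norm t u))
    (g := fun s => f (x + (v + s • e))) fun t ht => (hTE ht).2.le
  have hpow : (D ^ (1 / k : ℝ) * ε ^ (1 / k : ℝ)) ^ k = D * ε := by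
    rw [mul_pow, one_div, Real.rpow_inv_natCast_pow hD0.le hk.ne',
      Real.rpow_inv_natCast_pow hε.le hk.ne']
  rw [hpow] at hsmall
  have hlow : c / 2 ≤ ‖dividedDiff T (fun s => f (x + (v + s • e)))‖ := by
    have := norm_sub_norm_le (p k (fun _ => e)) (dividedDiff T (fun s => f (x + (v + s • e))))
    rw [norm_sub_rev] at this
    linarith
  have hcontra : c / 2 * (D * ε) ≤ (k + 1) * ε :=
    (mul_le_mul_of_nonneg_right hlow (by positivity)).trans hsmall
  have hDc : c / 2 * (D * ε) = 2 * ((k + 1) * ε) := by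
    rw [hD]
    field_simp
    ring
  have : 0 < (k + 1) * ε := by positivity
  linarith

end PowerSeries

/-- The `k`-th partial derivative in the `i`-th coordinate is `k!` times the value at the `i`-th
basis vector of the degree-`k` term of the power series. -/
theorem HasFPowerSeriesAt.iteratedPartialDeriv_eq {K : Type*} [NontriviallyNormedField K]
    [CompleteSpace K] {m : ℕ} {f : (Fin m → K) → K}
    {p : FormalMultilinearSeries K (Fin m → K) K} {x : Fin m → K} (hf : HasFPowerSeriesAt f p x)
    (i : Fin m) (k : ℕ) :
    iteratedPartialDeriv i k f x = k.factorial • p k (fun _ => Pi.single i 1) := by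
  set e : Fin m → K := Pi.single i 1 with he
  set q : FormalMultilinearSeries K K K :=
    fun j => ContinuousMultilinearMap.mkPiRing K (Fin j) (p j (fun _ => e)) with hq
  have hline : ∀ s : K, Function.update x i (x i + s) = x + s • e := by
    intro s
    ext j
    by_cases hj : j = i
    · subst hj
      simp [he]
    · simp [he, hj]
  have hg : HasFPowerSeriesAt (fun t => f (Function.update x i t)) q (x i) := by
    rw [hasFPowerSeriesAt_iff]
    obtain ⟨R, hR⟩ := hf
    have hcont : Tendsto (fun s : K => s • e) (𝓝 0) (𝓝 0) := by
      have : Continuous fun s : K => s • e := by fun_prop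
      simpa using this.tendsto 0
    filter_upwards [hcont (eball_mem_nhds 0 hR.r_pos)] with s hs
    rw [hline]
    convert hR.hasSum hs using 2 with j
    have hsm : (fun _ : Fin j => s • e) = fun l => (fun _ => s) l • (fun _ => e) l := rfl
    rw [hsm, (p j).map_smul_univ]
    simp [FormalMultilinearSeries.coeff, hq]
  obtain ⟨R, hR⟩ := hg
  have h := hR.factorial_smul 1 k
  rw [iteratedPartialDeriv, iteratedDeriv_eq_iteratedFDeriv, ← h]
  simp [hq]

/-! ### Haar measure of small balls -/

theorem exists_separated_finset_real {r : ℝ} (hr : 0 < r) (hr1 : r ≤ 1) :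
    ∃ S : Finset ℝ, (∀ s ∈ S, ‖s‖ ≤ 1) ∧ (∀ s ∈ S, ∀ t ∈ S, s ≠ t → r ≤ dist s t) ∧
      1 ≤ 2 * r * S.card := by
  have hinj : Function.Injective fun j : ℕ => (j : ℝ) * r := fun i j hij => by
    simpa [hr.ne'] using hij
  refine ⟨(Finset.range ⌊1 / r⌋₊).map ⟨_, hinj⟩, ?_, ?_, ?_⟩
  · intro s hs
    obtain ⟨j, hj, rfl⟩ := Finset.mem_map.1 hs
    have hj' : (j : ℝ) ≤ 1 / r :=
      (Nat.cast_le.2 (Finset.mem_range.1 hj).le).trans (Nat.floor_le (by positivity))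
    simpa [abs_of_pos hr] using (le_div_iff₀ hr).1 hj'
  · intro s hs t ht hst
    obtain ⟨i, -, rfl⟩ := Finset.mem_map.1 hs
    obtain ⟨j, -, rfl⟩ := Finset.mem_map.1 ht
    have hij : i ≠ j := fun h => hst (by rw [h])
    have h1 : (1 : ℝ) ≤ |(i : ℝ) - j| := by
      have h := Int.one_le_abs (sub_ne_zero.2 (Int.natCast_inj.ne.2 hij))
      exact_mod_cast h
    simp only [Function.Embedding.coeFn_mk, Real.dist_eq, ← sub_mul, abs_mul, abs_of_pos hr]
    nlinarith
  · rw [Finset.card_map, Finset.card_range]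
    have h1 : (1 : ℝ) ≤ ⌊1 / r⌋₊ := by
      exact_mod_cast Nat.le_floor (by simpa using (one_le_div hr).2 hr1)
    have h2 : 1 / r < ⌊1 / r⌋₊ + 1 := Nat.lt_floor_add_one _
    rw [div_lt_iff₀ hr] at h2
    nlinarith

theorem exists_separated_finset_padic (p : ℕ) [Fact p.Prime] {r : ℝ} (hr : 0 < r) (hr1 : r ≤ 1) :
    ∃ S : Finset ℚ_[p], (∀ s ∈ S, ‖s‖ ≤ 1) ∧ (∀ s ∈ S, ∀ t ∈ S, s ≠ t → r ≤ dist s t) ∧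
      1 ≤ p * r * S.card := by
  have hp : (1 : ℝ) < p := by exact_mod_cast (Fact.out : p.Prime).one_lt
  obtain ⟨m, hmr, hrm⟩ := exists_nat_pow_near_of_lt_one hr hr1
    (inv_pos.2 (zero_lt_one.trans hp)) (inv_lt_one_of_one_lt₀ hp)
  -- The integers `0, …, p ^ m - 1` are distinct modulo `p ^ m`.
  refine ⟨(Finset.range (p ^ m)).map ⟨fun j : ℕ => (j : ℚ_[p]), Nat.cast_injective⟩, ?_, ?_, ?_⟩
  · intro s hs
    obtain ⟨j, -, rfl⟩ := Finset.mem_map.1 hs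
    exact Padic.norm_int_le_one (p := p) j
  · intro s hs t ht hst
    obtain ⟨i, hi, rfl⟩ := Finset.mem_map.1 hs
    obtain ⟨j, hj, rfl⟩ := Finset.mem_map.1 ht
    by_contra! hlt
    refine hst ?_
    have hle : ‖(((i : ℤ) - j : ℤ) : ℚ_[p])‖ ≤ (p : ℝ) ^ (-m : ℤ) := by
      rw [zpow_neg, zpow_natCast, ← inv_pow]
      refine le_trans (le_of_eq ?_) (hlt.le.trans hrm)
      simp [dist_eq_norm]
    rw [Padic.norm_int_le_pow_iff_dvd] at hle
    have hmod : j ≡ i [MOD p ^ m] := (Nat.modEq_iff_dvd).2 (by exact_mod_cast hle)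
    have := Nat.ModEq.eq_of_lt_of_lt hmod (Finset.mem_range.1 hj) (Finset.mem_range.1 hi)
    simp [this]
  · rw [Finset.card_map, Finset.card_range]
    have hpow : (0 : ℝ) < (p : ℝ) ^ (m + 1) := by positivity
    rw [inv_pow, inv_lt_iff_one_lt_mul₀ hpow] at hmr
    push_cast
    rw [pow_succ] at hmr
    linarith

/-- The unit ball of `ℝ` or `ℚ_p` contains at least `c / r` points with mutual distances at least
`r`. This is how the one-dimensionality of the base field enters the measure estimates. -/
theorem IsRatCompletion.exists_separated_finset {F : Type} [NontriviallyNormedField F]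
    (hF : IsRatCompletion F) :
    ∃ A : ℝ, 0 < A ∧ ∀ r : ℝ, 0 < r → r ≤ 1 → ∃ S : Finset F, (∀ s ∈ S, ‖s‖ ≤ 1) ∧
      (∀ s ∈ S, ∀ t ∈ S, s ≠ t → r ≤ dist s t) ∧ 1 ≤ A * r * S.card := by
  cases hF with
  | real => exact ⟨2, two_pos, fun r hr hr1 => exists_separated_finset_real hr hr1⟩
  | padic p =>
    exact ⟨p, by exact_mod_cast (Fact.out : p.Prime).pos,
      fun r hr hr1 => exists_separated_finset_padic p hr hr1⟩

theorem IsRatCompletion.properSpace {F : Type} [NontriviallyNormedField F]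
    (hF : IsRatCompletion F) : ProperSpace F := by
  cases hF <;> infer_instance

theorem measure_ball_eq_measure_ball_zero {E : Type*} [NormedAddCommGroup E] [MeasurableSpace E]
    [BorelSpace E] (ν : Measure E) [ν.IsAddLeftInvariant] (x : E) (r : ℝ) :
    ν (ball x r) = ν (ball 0 r) := by
  rw [← measure_preimage_add ν (-x) (ball 0 r)]
  congr 1
  ext z
  simp [dist_eq_norm, sub_eq_neg_add]

/-- A ball of radius `r` in a space of dimension `b` over `ℝ` or `ℚ_p` has Haar measure
`O(r ^ b)`: about `r ^ (-b)` disjoint translates of it fit into a fixed ball. The intersection with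
the unit ball makes the bound hold for large `r` too. -/
theorem IsRatCompletion.exists_measure_ball_le {F : Type} [NontriviallyNormedField F]
    (hF : IsRatCompletion F) {E : Type*} [NormedAddCommGroup E] [NormedSpace F E]
    [FiniteDimensional F E] [MeasurableSpace E] [BorelSpace E] (ν : Measure E)
    [ν.IsAddHaarMeasure] :
    ∃ A : ℝ, 0 ≤ A ∧ ∀ (x : E) (r : ℝ), 0 < r →
      ν (ball x r ∩ closedBall 0 1) ≤ ENNReal.ofReal (A * r ^ Module.finrank F E) := by
  have : ProperSpace F := hF.properSpace
  have : ProperSpace E := FiniteDimensional.proper F E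
  obtain ⟨A, hA, hsep⟩ := hF.exists_separated_finset
  set b := Module.finrank F E
  set e : E ≃L[F] (Fin b → F) := (Module.finBasis F E).equivFunL
  set c : ℝ := ‖(e : E →L[F] (Fin b → F))‖ + 1 with hc
  have hc1 : 1 ≤ c := by simp [hc]
  set M : ℝ := ‖(e.symm : (Fin b → F) →L[F] E)‖ + 1 with hM
  have hfin : ∀ R, ν (closedBall 0 R) ≠ ⊤ := fun R =>
    (isCompact_closedBall (0 : E) R).measure_lt_top.ne
  set V : ℝ := (ν (closedBall 0 M)).toReal
  set W : ℝ := (ν (closedBall 0 1)).toReal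
  have hsmall : ∀ (x : E) (r : ℝ), 0 < r → 2 * c * r ≤ 1 →
      ν (ball x r) ≤ ENNReal.ofReal ((A * (2 * c)) ^ b * V * r ^ b) := by
    intro x r hr hr1
    obtain ⟨S, hS1, hSr, hScard⟩ := hsep (2 * c * r) (by positivity) hr1
    set P : Finset (Fin b → F) := Fintype.piFinset fun _ => S
    have hdisj : (P : Set (Fin b → F)).PairwiseDisjoint fun y => ball (e.symm y) r := by
      intro y hy z hz hyz
      obtain ⟨i, hi⟩ := Function.ne_iff.1 hyz
      refine ball_disjoint_ball ?_
      have h1 : 2 * c * r ≤ dist y z :=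
        (hSr _ (Fintype.mem_piFinset.1 hy i) _ (Fintype.mem_piFinset.1 hz i) hi).trans
          (dist_le_pi_dist y z i)
      have h2 : dist y z ≤ c * dist (e.symm y) (e.symm z) := by
        have h := (e : E →L[F] (Fin b → F)).le_opNorm (e.symm y - e.symm z)
        rw [dist_eq_norm, dist_eq_norm]
        refine le_trans (le_of_eq ?_) (h.trans ?_)
        · simp
        · gcongr
          simp [hc]
      have h3 : c * (r + r) ≤ c * dist (e.symm y) (e.symm z) := by linarith
      exact le_of_mul_le_mul_left h3 (by linarith)
    have hsub : (⋃ y ∈ P, ball (e.symm y) r) ⊆ closedBall 0 M := by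
      refine Set.iUnion₂_subset fun y hy => ?_
      refine ball_subset_closedBall.trans (closedBall_subset_closedBall' ?_)
      have hy1 : ‖y‖ ≤ 1 := (pi_norm_le_iff_of_nonneg zero_le_one).2
        fun i => hS1 _ (Fintype.mem_piFinset.1 hy i)
      have h := (e.symm : (Fin b → F) →L[F] E).le_opNorm_of_le hy1
      have hr' : r ≤ 1 := by nlinarith
      rw [dist_zero_right]
      have h' : ‖e.symm y‖ ≤ ‖(e.symm : (Fin b → F) →L[F] E)‖ := by simpa using h
      linarith
    have hcount : ((S.card : ℝ) ^ b) * (ν (ball 0 r)).toReal ≤ V := by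
      have h : (P.card : ENNReal) * ν (ball 0 r) ≤ ν (closedBall 0 M) := by
        rw [← nsmul_eq_mul, ← Finset.sum_const]
        calc _ = ∑ y ∈ P, ν (ball (e.symm y) r) :=
              Finset.sum_congr rfl fun y _ => (measure_ball_eq_measure_ball_zero ν _ r).symm
          _ = ν (⋃ y ∈ P, ball (e.symm y) r) :=
              (measure_biUnion_finset hdisj fun _ _ => measurableSet_ball).symm
          _ ≤ _ := measure_mono hsub
      have h' := ENNReal.toReal_mono (hfin M) h
      rw [ENNReal.toReal_mul, ENNReal.toReal_natCast, Fintype.card_piFinset_const] at h'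
      simpa using h'
    have hball : ν (ball 0 r) ≠ ⊤ :=
      ((measure_mono ball_subset_closedBall).trans_lt (hfin r).lt_top).ne
    rw [measure_ball_eq_measure_ball_zero, ← ENNReal.ofReal_toReal hball]
    refine ENNReal.ofReal_le_ofReal ?_
    calc (ν (ball 0 r)).toReal ≤ (A * (2 * c * r) * S.card) ^ b * (ν (ball 0 r)).toReal :=
          le_mul_of_one_le_left ENNReal.toReal_nonneg (one_le_pow₀ hScard)
      _ = (A * (2 * c)) ^ b * r ^ b * (S.card ^ b * (ν (ball 0 r)).toReal) := by
          simp only [mul_pow]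
          ring
      _ ≤ (A * (2 * c)) ^ b * r ^ b * V := by gcongr
      _ = _ := by ring
  have hV : 0 ≤ V := ENNReal.toReal_nonneg
  have hW : 0 ≤ W := ENNReal.toReal_nonneg
  refine ⟨(A * (2 * c)) ^ b * V + (2 * c) ^ b * W, by positivity, fun x r hr => ?_⟩
  rcases le_total (2 * c * r) 1 with hr1 | hr1
  · refine (measure_mono Set.inter_subset_left).trans ((hsmall x r hr hr1).trans ?_)
    refine ENNReal.ofReal_le_ofReal ?_
    gcongr
    exact le_add_of_nonneg_right (by positivity)
  · refine (measure_mono Set.inter_subset_right).trans ?_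
    rw [← ENNReal.ofReal_toReal (hfin 1)]
    refine ENNReal.ofReal_le_ofReal ?_
    calc W ≤ (2 * c * r) ^ b * W := le_mul_of_one_le_left hW (one_le_pow₀ hr1)
      _ ≤ (A * (2 * c)) ^ b * V * r ^ b + (2 * c * r) ^ b * W :=
          le_add_of_nonneg_left (by positivity)
      _ = _ := by simp only [mul_pow]; ring

/-! ### Fubini -/

/-- Fubini bound: a measurable subset of a box whose lines parallel to the last axis have small
slices is small. -/
theorem pi_measure_le_of_slice_le {K : Type*} [MeasurableSpace K] {n : ℕ} (ν : Measure K)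
    [SigmaFinite ν] {A : Set (Fin (n + 1) → K)} (hA : MeasurableSet A) {B : Set (Fin n → K)}
    (hB : MeasurableSet B) (hAB : ∀ x ∈ A, Fin.init x ∈ B) {M : ENNReal}
    (hslice : ∀ x ∈ A, ν {t | Function.update x (Fin.last n) t ∈ A} ≤ M) :
    Measure.pi (fun _ => ν) A ≤ M * Measure.pi (fun _ => ν) B := by
  have hφ := (measurePreserving_piFinSuccAbove (fun _ : Fin (n + 1) => ν) (Fin.last n)).symm
  rw [← hφ.measure_preimage hA.nullMeasurableSet,
    Measure.prod_apply_symm (hφ.measurable hA)]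
  calc _ ≤ ∫⁻ y : Fin n → K, B.indicator (fun _ => M) y ∂Measure.pi (fun _ => ν) := by
        refine lintegral_mono fun y => ?_
        have hmem : ∀ t : K, t ∈ (fun x => (x, y)) ⁻¹'
            ((MeasurableEquiv.piFinSuccAbove (fun _ => K) (Fin.last n)).symm ⁻¹' A) ↔
              (Fin.snoc y t : Fin (n + 1) → K) ∈ A := by
          intro t
          rw [← Fin.insertNth_last']
          rfl
        rcases Set.eq_empty_or_nonempty ((fun x => (x, y)) ⁻¹'
            ((MeasurableEquiv.piFinSuccAbove (fun _ => K) (Fin.last n)).symm ⁻¹' A)) with h | h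
        · simp only [h, measure_empty, zero_le]
        · obtain ⟨t₀, ht₀⟩ := h
          rw [hmem] at ht₀
          have hy : y ∈ B := by simpa using hAB _ ht₀
          rw [Set.indicator_of_mem hy]
          refine (measure_mono fun t ht => ?_).trans (hslice _ ht₀)
          rw [hmem] at ht
          simpa [Fin.update_snoc_last] using ht
    _ = _ := by rw [lintegral_indicator_const hB]

/-! ### The sublevel estimate -/

/-- The sublevel estimate near one point, for the product Haar measure. -/
theorem exists_nhds_measure_sublevel_le {F : Type} [NontriviallyNormedField F]
    (hF : IsRatCompletion F) {K : Type*} [NontriviallyNormedField K] [NormedAlgebra F K]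
    [FiniteDimensional F K] [MeasurableSpace K] [BorelSpace K] {n : ℕ} (ν : Measure K)
    [ν.IsAddHaarMeasure] {f : (Fin (n + 1) → K) → K} {Z : Set (Fin (n + 1) → K)}
    (hZ : IsClosed Z) (hfZ : ContinuousOn f Z) {x₀ : Fin (n + 1) → K} (hf : AnalyticAt K f x₀)
    {k : ℕ} (hk : 0 < k) (hderiv : iteratedPartialDeriv (Fin.last n) k f x₀ ≠ 0) :
    ∃ V ∈ 𝓝 x₀, ∃ B : ℝ, 0 ≤ B ∧ ∀ ε : ℝ, 0 < ε →
      Measure.pi (fun _ => ν) {x | x ∈ Z ∩ V ∧ ‖f x‖ < ε} ≤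
        ENNReal.ofReal (B * ε ^ ((Module.finrank F K : ℝ) / (k : ℝ))) := by
  have : ProperSpace F := hF.properSpace
  have : ProperSpace K := FiniteDimensional.proper F K
  obtain ⟨p, hp⟩ := hf
  set e : Fin (n + 1) → K := Pi.single (Fin.last n) 1 with he
  have he1 : ‖e‖ ≤ 1 := by
    rw [he, Pi.norm_single, norm_one]
  have hpe : p k (fun _ => e) ≠ 0 := by
    intro h
    rw [hp.iteratedPartialDeriv_eq, ← he, h, smul_zero] at hderiv
    exact hderiv rfl
  obtain ⟨C, hC, ρ, hρ, hρ1, hcov⟩ := hp.exists_sublevel_cover he1 hk hpe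
  obtain ⟨A, hA, hball⟩ := hF.exists_measure_ball_le ν
  set b := Module.finrank F K
  set Q : Set (Fin n → K) := closedBall (Fin.init x₀) ρ
  have hQ : Measure.pi (fun _ => ν) Q ≠ ⊤ := (isCompact_closedBall _ _).measure_lt_top.ne
  set q : ℝ := (Measure.pi (fun _ => ν) Q).toReal
  refine ⟨closedBall x₀ ρ, closedBall_mem_nhds x₀ hρ, k * (A * C ^ b) * q, by positivity, ?_⟩
  intro ε hε
  set δ : ℝ := C * ε ^ (1 / k : ℝ) with hδ
  have hδ0 : 0 < δ := by positivity
  set S : Set (Fin (n + 1) → K) := {x | x ∈ Z ∩ closedBall x₀ ρ ∧ ‖f x‖ < ε}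
  have hSmeas : MeasurableSet S := by
    have hcl : IsClosed (Z ∩ closedBall x₀ ρ) := hZ.inter isClosed_closedBall
    obtain ⟨O, hO, hOe⟩ := (_root_.continuousOn_iff'.1
      (hfZ.mono (Set.inter_subset_left (t := closedBall x₀ ρ)))) (ball 0 ε) isOpen_ball
    have : S = f ⁻¹' ball 0 ε ∩ (Z ∩ closedBall x₀ ρ) := by
      ext x
      simp [S, and_comm]
    rw [this, hOe]
    exact hO.measurableSet.inter hcl.measurableSet
  have hinit : ∀ x ∈ S, Fin.init x ∈ Q := by
    intro x hx
    refine (dist_pi_le_iff hρ.le).2 fun i => ?_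
    exact (dist_le_pi_dist x x₀ i.castSucc).trans hx.1.2
  have hslice : ∀ x ∈ S, ν {t | Function.update x (Fin.last n) t ∈ S} ≤
      ENNReal.ofReal (k * (A * δ ^ b)) := by
    intro x hx
    set a : K := x₀ (Fin.last n)
    set v : Fin (n + 1) → K := Function.update x (Fin.last n) a - x₀ with hv
    have hvρ : ‖v‖ ≤ ρ := by
      refine (pi_norm_le_iff_of_nonneg hρ.le).2 fun i => ?_
      rcases eq_or_ne i (Fin.last n) with rfl | hi
      · simpa [hv, a] using hρ.le
      · have h := (dist_le_pi_dist x x₀ i).trans hx.1.2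
        rwa [dist_eq_norm, ← Function.update_of_ne hi a x] at h
    have hline : ∀ t, Function.update x (Fin.last n) t = x₀ + (v + (-a + t) • e) := by
      intro t
      ext i
      rcases eq_or_ne i (Fin.last n) with rfl | hi
      · simp [hv, he, a]
      · simp [hv, he, hi]
    obtain ⟨T, hTk, hT⟩ := hcov v hvρ ε hε
    calc ν {t | Function.update x (Fin.last n) t ∈ S}
        ≤ ν ((fun t => -a + t) ⁻¹' ⋃ τ ∈ T, (ball τ δ ∩ closedBall 0 1)) := by
          refine measure_mono fun t ht => ?_
          have hta : ‖-a + t‖ ≤ ρ := by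
            have h := (dist_le_pi_dist _ x₀ (Fin.last n)).trans ht.1.2
            rw [Function.update_self, dist_eq_norm] at h
            rwa [neg_add_eq_sub]
          have hfe : ‖f (x₀ + (v + (-a + t) • e))‖ < ε := by
            rw [← hline]
            exact ht.2
          have h := hT ⟨hta, hfe⟩
          simp only [Set.mem_iUnion] at h
          obtain ⟨τ, hτ, hmem⟩ := h
          simp only [Set.mem_preimage, Set.mem_iUnion]
          exact ⟨τ, hτ, hmem, by simpa using hta.trans hρ1⟩
      _ = ν (⋃ τ ∈ T, (ball τ δ ∩ closedBall 0 1)) := measure_preimage_add ν _ _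
      _ ≤ ∑ τ ∈ T, ν (ball τ δ ∩ closedBall 0 1) := measure_biUnion_finset_le _ _
      _ ≤ ∑ _τ ∈ T, ENNReal.ofReal (A * δ ^ b) := Finset.sum_le_sum fun τ _ => hball τ δ hδ0
      _ = T.card * ENNReal.ofReal (A * δ ^ b) := by rw [Finset.sum_const, nsmul_eq_mul]
      _ ≤ k * ENNReal.ofReal (A * δ ^ b) := by gcongr
      _ = _ := by rw [ENNReal.ofReal_mul (Nat.cast_nonneg k), ENNReal.ofReal_natCast]
  refine (pi_measure_le_of_slice_le ν hSmeas measurableSet_closedBall hinit hslice).trans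
    (le_of_eq ?_)
  rw [← ENNReal.ofReal_toReal hQ, ← ENNReal.ofReal_mul (by positivity)]
  have hpow : (ε ^ (1 / k : ℝ)) ^ b = ε ^ ((b : ℝ) / k) := by
    rw [← Real.rpow_natCast, ← Real.rpow_mul hε.le, one_div_mul_eq_div]
  rw [hδ, mul_pow, hpow]
  congr 1
  ring

/-- Sublevel estimate on `K ^ (n + 1)`, whose last coordinate has index `Fin.last n`. The measure
is an arbitrary Haar measure, so every normalization is covered. -/
theorem theorem2p1 {F : Type} [NontriviallyNormedField F] (hF : IsRatCompletion F)
    {K : Type*} [NontriviallyNormedField K] [NormedAlgebra F K] [FiniteDimensional F K]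
    [MeasurableSpace K] [BorelSpace K] (n : ℕ)
    (μ : MeasureTheory.Measure (Fin (n + 1) → K)) [μ.IsAddHaarMeasure]
    (U : Set (Fin (n + 1) → K)) (hU : U ∈ nhds 0) (hUb : Bornology.IsBounded U)
    (f : (Fin (n + 1) → K) → K) (hf : AnalyticOnNhd K f (closure U))
    (k : ℕ) (hk : 0 < k)
    (hderiv : ∀ x ∈ closure U, iteratedPartialDeriv (Fin.last n) k f x ≠ 0) :
    ∃ B : ℝ, ∀ ε : ℝ, 0 < ε →
      μ {x | x ∈ U ∧ ‖f x‖ < ε} <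
        ENNReal.ofReal (B * ε ^ ((Module.finrank F K : ℝ) / (k : ℝ))) := by
  have : ProperSpace F := hF.properSpace
  have : ProperSpace K := FiniteDimensional.proper F K
  let ν : Measure K := Measure.addHaar
  have hμ : μ = μ.addHaarScalarFactor (Measure.pi fun _ => ν) • Measure.pi fun _ => ν :=
    Measure.isAddLeftInvariant_eq_smul _ _
  set c := μ.addHaarScalarFactor (Measure.pi fun _ => ν)
  have hloc : ∀ x ∈ closure U, ∃ V ∈ 𝓝 x, ∃ B : ℝ, 0 ≤ B ∧ ∀ ε : ℝ, 0 < ε →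
      Measure.pi (fun _ => ν) {x | x ∈ closure U ∩ V ∧ ‖f x‖ < ε} ≤
        ENNReal.ofReal (B * ε ^ ((Module.finrank F K : ℝ) / (k : ℝ))) := fun x hx =>
    exists_nhds_measure_sublevel_le hF ν isClosed_closure hf.continuousOn (hf x hx) hk
      (hderiv x hx)
  choose! V hV B hB hVB using hloc
  obtain ⟨I, hI, hcover⟩ := hUb.isCompact_closure.elim_nhds_subcover V hV
  -- The summand `1` makes the inequality strict.
  refine ⟨c * ∑ x ∈ I, B x + 1, fun ε hε => ?_⟩
  set w : ℝ := ε ^ ((Module.finrank F K : ℝ) / (k : ℝ))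
  have hw : 0 < w := by positivity
  have hsum : 0 ≤ ∑ x ∈ I, B x := Finset.sum_nonneg fun x hx => hB x (hI x hx)
  have hpi : Measure.pi (fun _ => ν) {x | x ∈ U ∧ ‖f x‖ < ε} ≤
      ENNReal.ofReal ((∑ x ∈ I, B x) * w) := by
    calc _ ≤ Measure.pi (fun _ => ν) (⋃ x ∈ I, {y | y ∈ closure U ∩ V x ∧ ‖f y‖ < ε}) := by
          refine measure_mono fun y hy => ?_
          have hyU := subset_closure hy.1
          have h := hcover hyU
          simp only [Set.mem_iUnion] at h ⊢
          obtain ⟨x, hx, hyx⟩ := h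
          exact ⟨x, hx, ⟨hyU, hyx⟩, hy.2⟩
      _ ≤ ∑ x ∈ I, Measure.pi (fun _ => ν) {y | y ∈ closure U ∩ V x ∧ ‖f y‖ < ε} :=
          measure_biUnion_finset_le _ _
      _ ≤ ∑ x ∈ I, ENNReal.ofReal (B x * w) :=
          Finset.sum_le_sum fun x hx => hVB x (hI x hx) ε hε
      _ = ENNReal.ofReal (∑ x ∈ I, B x * w) :=
          (ENNReal.ofReal_sum_of_nonneg fun x hx => mul_nonneg (hB x (hI x hx)) hw.le).symm
      _ = _ := by rw [Finset.sum_mul]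
  calc μ {x | x ∈ U ∧ ‖f x‖ < ε} = c * Measure.pi (fun _ => ν) {x | x ∈ U ∧ ‖f x‖ < ε} := by
        rw [hμ]
        rfl
    _ ≤ c * ENNReal.ofReal ((∑ x ∈ I, B x) * w) := by gcongr
    _ = ENNReal.ofReal (c * (∑ x ∈ I, B x) * w) := by
        rw [mul_assoc, ENNReal.ofReal_mul c.coe_nonneg, ENNReal.ofReal_coe_nnreal]
    _ < _ := by
        refine (ENNReal.ofReal_lt_ofReal_iff (by positivity)).2 ?_
        linarith
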